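/- **Model.** $n$ anonymous devices share a single-hop channel and act in synchronous rounds $1,2,\dots$. In every round each device transmits a message, listens, or is idle. In the model without collision detection ($\mathsf{No}\text{-}\mathsf{CD}$), a listening device receives the message $m$ if exactly one device transmits in that round, and hears silence if zero or at least two devices transmit; transmitting and idle devices receive no feedback. All devices run the same randomized algorithm $\mathcal A$, each with its own independent private randomness (drawn from the same probability space) and with messages from a countable set. A device's next action and its output (still running, terminated as leader, terminated as non-leader) are determined by its private randomness and the feedback it has observed so far; the number $n$ of devices is unknown to it. A terminated device stays idle. The election is completed in the first round in which exactly one device transmits and terminates as the leader, all other devices listen and terminate as non-leaders, and no device has terminated before that round. The *time* of an execution is the number of rounds until this happens ($\infty$ if it never happens). The *energy of a device* is its number of non-idle rounds, and the *energy* of an execution is the maximum energy over all devices. Let $T(n)$ and $E(n)$ in $[0,\infty]$ be the expected time and the expected energy of $\mathcal A$ on $n$ devices. **Theorem 1 (Energy lower bound for Las Vegas algorithms).** For every integer $n^\ast\ge 2$ there is a constant $c>0$ such that the following holds for every randomized algorithm $\mathcal A$ in the $\mathsf{No}\text{-}\mathsf{CD}$ model. If the expected time $T(n^\ast)$ of electing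 a leader with $\mathcal A$ on $n^\ast$ devices is finite, then there are infinitely many network sizes $n$ such that $$E(n)\ \ge\ c\,\log\log n ,$$ and moreover, with probability at least $1/2$, the average energy over the $n$ devices in an execution of $\mathcal A$ on $n$ devices is at least $c\,\log\log n$. -/

import Mathlib

open MeasureTheory
open scoped ENNReal

noncomputable section

namespace NoCD

/-- What a device does in one round. -/
inductive Action (M : Type*) where
  | idle
  | listen
  | transmit (m : M)

/-- The message that an action puts on the channel, if any. -/
def Action.message? {M : Type*} : Action M → Option M
  | .idle => none
  | .listen => none
  | .transmit m => some m

/-- What a device observes in one round: transmitting and idle devices observe `nothing`, listening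
devices observe either `silence` or a message. -/
inductive Feedback (M : Type*) where
  | nothing
  | silence
  | message (m : M)

/-- The output of a device: it is still running, or it has terminated and identifies itself as the
leader or as a non-leader. -/
inductive Status where
  | running
  | leader
  | nonLeader

/-- A randomized algorithm for anonymous devices with message space `M`. Every device runs the same
algorithm on its own private random seed in `Ω`. Its next action and its current status are
determined by its seed and by the feedback that it has observed so far (in chronological order);
in particular they do not depend on the number of devices. -/
structure Algorithm (M Ω : Type*) [MeasurableSpace Ω] where
  action : Ω → List (Feedback M) → Action M
  status : Ω → List (Feedback M) → Status
  measurableSet_action : ∀ h a, MeasurableSet {ω | action ω h = a}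
  measurableSet_status : ∀ h s, MeasurableSet {ω | status ω h = s}

open Classical in
/-- The message delivered by the channel when the devices perform the actions `a`: there is one
exactly if exactly one device transmits. -/
def delivered {M : Type*} {n : ℕ} (a : Fin n → Action M) : Option M :=
  if h : ∃! u, (a u).message?.isSome then (a h.choose).message? else none

/-- The feedback of device `v` without collision detection: transmitters get no feedback, listeners
cannot distinguish a collision from silence. -/
def feedback {M : Type*} {n : ℕ} (a : Fin n → Action M) (v : Fin n) : Feedback M :=
  match a v with
  | .idle => .nothing
  | .transmit _ => .nothing
  | .listen =>
    match delivered a with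
    | none => .silence
    | some m => .message m

namespace Algorithm

variable {M Ω : Type*} [MeasurableSpace Ω]

open Classical in
/-- The action of a device with seed `ω` and past feedback `h`; a device that has terminated at the
current or an earlier point of time is idle. -/
def nextAction (A : Algorithm M Ω) (ω : Ω) (h : List (Feedback M)) : Action M :=
  if ∀ p, p <+: h → A.status ω p = .running then A.action ω h else .idle

/-- The feedback observed by each device in the first `r` rounds, when `n` devices with seeds `ω`
run the algorithm. -/
def history (A : Algorithm M Ω) {n : ℕ} (ω : Fin n → Ω) : ℕ → Fin n → List (Feedback M)
  | 0, _ => []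
  | r + 1, v =>
    history A ω r v ++ [feedback (fun u => A.nextAction (ω u) (history A ω r u)) v]

/-- The action of device `v` in round `r` (the first round is round `0`). -/
def actionAt (A : Algorithm M Ω) {n : ℕ} (ω : Fin n → Ω) (r : ℕ) (v : Fin n) : Action M :=
  A.nextAction (ω v) (A.history ω r v)

/-- The status of device `v` after the first `r` rounds. -/
def statusAfter (A : Algorithm M Ω) {n : ℕ} (ω : Fin n → Ω) (r : ℕ) (v : Fin n) : Status :=
  A.status (ω v) (A.history ω r v)

/-- The protocol ends successfully with round `r`: no device has terminated before, and in round `r`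
one device transmits and terminates as the leader while all other devices listen and terminate as
non-leaders. -/
def ElectsAt (A : Algorithm M Ω) {n : ℕ} (ω : Fin n → Ω) (r : ℕ) : Prop :=
  (∀ s ≤ r, ∀ v, A.statusAfter ω s v = .running) ∧
    ∃ l : Fin n, (∃ m, A.actionAt ω r l = .transmit m) ∧ A.statusAfter ω (r + 1) l = .leader ∧
      ∀ v, v ≠ l → A.actionAt ω r v = .listen ∧ A.statusAfter ω (r + 1) v = .nonLeader

/-- The number of rounds until a leader is elected (`∞` if this never happens). -/
def time (A : Algorithm M Ω) {n : ℕ} (ω : Fin n → Ω) : ℝ≥0∞ :=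
  ⨅ (r : ℕ) (_ : A.ElectsAt ω r), ((r + 1 : ℕ) : ℝ≥0∞)

/-- The energy used by device `v`: its number of non-idle rounds. -/
def energy (A : Algorithm M Ω) {n : ℕ} (ω : Fin n → Ω) (v : Fin n) : ℝ≥0∞ :=
  (({r : ℕ | A.actionAt ω r v ≠ .idle}.encard : ℕ∞) : ℝ≥0∞)

/-- The energy of an execution: the maximum energy over all devices. -/
def maxEnergy (A : Algorithm M Ω) {n : ℕ} (ω : Fin n → Ω) : ℝ≥0∞ :=
  ⨆ v, A.energy ω v

/-- The average energy per device of an execution. -/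
def averageEnergy (A : Algorithm M Ω) {n : ℕ} (ω : Fin n → Ω) : ℝ≥0∞ :=
  (∑ v, A.energy ω v) / n

/-- The expected time on `n` devices, whose seeds are independent with distribution `μ`. -/
def expectedTime (A : Algorithm M Ω) (μ : Measure Ω) (n : ℕ) : ℝ≥0∞ :=
  ∫⁻ ω : Fin n → Ω, A.time ω ∂(Measure.pi fun _ => μ)

/-- The expected (maximum) energy on `n` devices, whose seeds are independent with distribution
`μ`. -/
def expectedEnergy (A : Algorithm M Ω) (μ : Measure Ω) (n : ℕ) : ℝ≥0∞ :=
  ∫⁻ ω : Fin n → Ω, A.maxEnergy ω ∂(Measure.pi fun _ => μ)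

end Algorithm

end NoCD

end

/-!
The proof compares executions with the *blind* behaviour of a device: the actions that its seed
prescribes as long as every round in which it listens turns out silent. An execution agrees with the
blind behaviour of all devices until some round has a listener and exactly one transmitter
(`history_eq_blindHistory`). Two facts about the blind behaviour carry the argument.

*Fast election needs blind energy.* Let a device be blindly non-idle fewer than `m` times in the
first `r` rounds. A uniformly random string `z : Fin r → Bool`, read as "transmit" or "listen" in
each round, agrees with all its non-idle actions with probability at least `2 ^ (-m)`. So some fixed
`z` agrees with a random device with probability at least `2 ^ (-m) * μ {blindEnergy < m}`
(`exists_compatible_measure`). If all `nStar` devices agree with the same `z`, no round has both a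
transmitter and a listener, so no leader is elected within `r` rounds. Finite expected time on
`nStar` devices therefore forces `μ {blindEnergy < m} ≤ 1 / 8` for some `m` of order `log r`
(`measure_blindEnergy_lt_le`).

*On some network sizes everybody stays blind for long.* If a device blindly transmits in a round
with probability `p`, then exactly one of `n` devices does so with probability
`n p (1 - p) ^ (n - 1)`, which is at most `1 / (4 r)` unless `n p` lies in `(1 / (4 r), 32 r)`
(`exactly_one_le_of_extreme`). Among the `r + 1` sizes `(128 r²) ^ (j + 1)`, each of the `r` rounds
excludes at most one, so some size `n` is good for all rounds (`exists_size_avoiding`). For this `n`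
the execution is blind during the first `r` rounds with probability at least `3 / 4`; by Markov's
inequality at least half of the devices have blind energy at least `m`, again with probability at
least `3 / 4`. Hence the average energy is at least `m / 2` with probability at least `1 / 2`, while
`log log n ≤ 3 log r = O(m)` (`log_log_size_le`).
-/

/-! ### Blind behaviour of a device -/

namespace NoCD

variable {M Ω : Type*}

/-- The feedback of a device that performs the given action when no message is delivered. -/
def blindFeedback : Action M → Feedback M
  | .idle => .nothing
  | .listen => .silence
  | .transmit _ => .nothing

instance [Countable M] : Countable (Feedback M) := by
  let f : Feedback M → Option (Option M) := fun x => match x with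
    | .nothing => none
    | .silence => some none
    | .message m => some (some m)
  refine Function.Injective.countable (f := f) ?_
  intro x y h
  cases x <;> cases y <;> simp_all [f]

theorem isSome_message?_iff (a : Action M) :
    a.message?.isSome ↔ a ≠ .idle ∧ a ≠ .listen := by
  cases a <;> simp [Action.message?]

theorem feedback_eq_blindFeedback {n : ℕ} (a : Fin n → Action M) (v : Fin n)
    (h : a v = .listen → ¬ ∃! u, (a u).message?.isSome) :
    feedback a v = blindFeedback (a v) := by
  unfold feedback
  cases hv : a v with
  | idle => rfl
  | transmit m => rfl
  | listen =>
    have : delivered a = none := by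
      unfold delivered
      rw [dif_neg (h hv)]
    simp [this, blindFeedback]

namespace Algorithm

variable [MeasurableSpace Ω]

/-- The feedback that a device with seed `ω` observes in the first `r` rounds if it hears silence
whenever it listens. It does not depend on the other devices. -/
noncomputable def blindHistory (A : Algorithm M Ω) (ω : Ω) : ℕ → List (Feedback M)
  | 0 => []
  | r + 1 => blindHistory A ω r ++ [blindFeedback (A.nextAction ω (blindHistory A ω r))]

/-- The action in round `r` of a device with seed `ω` that has heard only silence so far. -/
noncomputable def blindAction (A : Algorithm M Ω) (ω : Ω) (r : ℕ) : Action M :=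
  A.nextAction ω (A.blindHistory ω r)

open Classical in
/-- The number of non-idle rounds among the first `r` rounds of the blind behaviour. -/
noncomputable def blindEnergy (A : Algorithm M Ω) (r : ℕ) (ω : Ω) : ℕ :=
  (Finset.univ.filter fun i : Fin r => A.blindAction ω i ≠ .idle).card

/-- As long as no round has both a listener and exactly one transmitter, nobody hears a message, so
that all devices follow their blind behaviour. -/
theorem history_eq_blindHistory (A : Algorithm M Ω) {n : ℕ} (ω : Fin n → Ω) (R : ℕ)
    (h : ∀ i < R, ∀ v, A.blindAction (ω v) i = .listen →
      ¬ ∃! u, (A.blindAction (ω u) i).message?.isSome) :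
    ∀ i ≤ R, ∀ v, A.history ω i v = A.blindHistory (ω v) i := by
  intro i
  induction i with
  | zero => intro _ v; rfl
  | succ i ih =>
    intro hi v
    have ih' := ih (by omega)
    simp only [history, blindHistory, ih']
    rw [feedback_eq_blindFeedback]
    exact h i (by omega) v

theorem actionAt_eq_blindAction (A : Algorithm M Ω) {n : ℕ} (ω : Fin n → Ω) (R : ℕ)
    (h : ∀ i < R, ∀ v, A.blindAction (ω v) i = .listen →
      ¬ ∃! u, (A.blindAction (ω u) i).message?.isSome) (i : ℕ) (hi : i < R) (v : Fin n) :
    A.actionAt ω i v = A.blindAction (ω v) i := by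
  rw [actionAt, history_eq_blindHistory A ω R h i hi.le v, blindAction]

theorem blindEnergy_le_energy (A : Algorithm M Ω) {n : ℕ} (ω : Fin n → Ω) (R : ℕ)
    (h : ∀ i < R, ∀ v, A.blindAction (ω v) i = .listen →
      ¬ ∃! u, (A.blindAction (ω u) i).message?.isSome) (v : Fin n) :
    (A.blindEnergy R (ω v) : ℝ≥0∞) ≤ A.energy ω v := by
  classical
  unfold energy blindEnergy
  have key : ((Finset.univ.filter fun i : Fin R => A.blindAction (ω v) i ≠ .idle).card : ℕ∞) ≤
      {r : ℕ | A.actionAt ω r v ≠ .idle}.encard := by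
    rw [← Set.encard_coe_eq_coe_finsetCard,
      ← (Fin.val_injective (n := R)).injOn.encard_image]
    apply Set.encard_le_encard
    rintro _ ⟨i, hi, rfl⟩
    simpa [actionAt_eq_blindAction A ω R h i i.2 v] using hi
  calc _ = (((Finset.univ.filter fun i : Fin R => A.blindAction (ω v) i ≠ .idle).card : ℕ∞) :
        ℝ≥0∞) := by simp
    _ ≤ _ := by exact_mod_cast key

/-! ### Measurability of the blind behaviour -/

theorem measurableSet_nextAction (A : Algorithm M Ω) (h : List (Feedback M)) (a : Action M) :
    MeasurableSet {ω | A.nextAction ω h = a} := by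
  have hR : MeasurableSet {ω | ∀ p, p <+: h → A.status ω p = .running} := by
    have : {ω | ∀ p, p <+: h → A.status ω p = .running} =
        ⋂ p ∈ {p | p ∈ h.inits}, {ω | A.status ω p = .running} := by
      ext ω; simp
    rw [this]
    exact MeasurableSet.biInter (List.finite_toSet _).countable
      fun p _ => A.measurableSet_status p _
  have : {ω | A.nextAction ω h = a} =
      {ω | ∀ p, p <+: h → A.status ω p = .running}.ite {ω | A.action ω h = a}
        {_ω | Action.idle = a} := by
    ext ω
    by_cases hω : ∀ p, p <+: h → A.status ω p = .running
    · simp only [Set.mem_ofPred_eq, nextAction, if_pos hω, Set.ite, Set.mem_union, Set.mem_inter_iff,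
        Set.mem_sdiff]
      tauto
    · simp only [Set.mem_ofPred_eq, nextAction, if_neg hω, Set.ite, Set.mem_union, Set.mem_inter_iff,
        Set.mem_sdiff]
      tauto
  rw [this]
  exact hR.ite (A.measurableSet_action h a) (MeasurableSet.const _)

theorem measurableSet_blindFeedback_nextAction (A : Algorithm M Ω) (h : List (Feedback M))
    (f : Feedback M) : MeasurableSet {ω | blindFeedback (A.nextAction ω h) = f} := by
  have hl := A.measurableSet_nextAction h .listen
  cases f with
  | silence =>
    convert hl using 3 with ω
    cases A.nextAction ω h <;> simp [blindFeedback]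
  | nothing =>
    convert hl.compl using 1
    ext ω
    simp only [Set.mem_ofPred_eq, Set.mem_compl_iff]
    cases A.nextAction ω h <;> simp [blindFeedback]
  | message m =>
    convert MeasurableSet.empty using 1
    ext ω
    simp only [Set.mem_ofPred_eq, Set.mem_empty_iff_false, iff_false]
    cases A.nextAction ω h <;> simp [blindFeedback]

theorem measurableSet_blindHistory (A : Algorithm M Ω) (r : ℕ) (h : List (Feedback M)) :
    MeasurableSet {ω | A.blindHistory ω r = h} := by
  induction r generalizing h with
  | zero => simp [blindHistory]
  | succ r ih =>
    rcases List.eq_nil_or_concat h with rfl | ⟨h', f, rfl⟩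
    · simp [blindHistory]
    · have : {ω | A.blindHistory ω (r + 1) = h'.concat f} =
          {ω | A.blindHistory ω r = h'} ∩ {ω | blindFeedback (A.nextAction ω h') = f} := by
        ext ω
        simp only [blindHistory, List.concat_eq_append, Set.mem_ofPred_eq, Set.mem_inter_iff]
        constructor
        · intro hω
          obtain ⟨h1, h2⟩ := List.append_inj' hω rfl
          subst h1
          simpa using h2
        · rintro ⟨rfl, rfl⟩
          rfl
      rw [this]
      exact (ih h').inter (A.measurableSet_blindFeedback_nextAction h' f)

/-- Countability of the message space enters here: the blind history takes countably many values. -/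
theorem measurableSet_blindAction [Countable M] (A : Algorithm M Ω) (r : ℕ) (a : Action M) :
    MeasurableSet {ω | A.blindAction ω r = a} := by
  have : {ω | A.blindAction ω r = a} = ⋃ h : List (Feedback M),
      {ω | A.blindHistory ω r = h} ∩ {ω | A.nextAction ω h = a} := by
    ext ω
    simp [blindAction]
  rw [this]
  exact MeasurableSet.iUnion fun h =>
    (A.measurableSet_blindHistory r h).inter (A.measurableSet_nextAction h a)

theorem measurableSet_blindTransmit [Countable M] (A : Algorithm M Ω) (r : ℕ) :
    MeasurableSet {ω | (A.blindAction ω r).message?.isSome} := by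
  simp_rw [isSome_message?_iff]
  exact (A.measurableSet_blindAction r _).compl.inter (A.measurableSet_blindAction r _).compl

theorem measurable_blindEnergy [Countable M] (A : Algorithm M Ω) (r : ℕ) :
    Measurable (A.blindEnergy r) := by
  classical
  unfold blindEnergy
  simp_rw [Finset.card_filter]
  refine Finset.measurable_sum _ fun i _ => ?_
  exact Measurable.ite (A.measurableSet_blindAction i _).compl measurable_const measurable_const

/-! ### Blind energy forced by a finite expected time -/

/-- The seeds whose blind behaviour in the first `r` rounds agrees with `z`, where `true` allows
transmitting and `false` allows listening; idling is always allowed. -/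
def compatible (A : Algorithm M Ω) {r : ℕ} (z : Fin r → Bool) : Set Ω :=
  {ω | ∀ i : Fin r, ((A.blindAction ω i).message?.isSome → z i = true) ∧
    (A.blindAction ω i = .listen → z i = false)}

theorem measurableSet_compatible [Countable M] (A : Algorithm M Ω) {r : ℕ} (z : Fin r → Bool) :
    MeasurableSet (A.compatible z) := by
  unfold compatible
  rw [Set.ofPred_forall]
  refine MeasurableSet.iInter fun i => ?_
  simp_rw [imp_iff_not_or]
  exact ((A.measurableSet_blindTransmit i).compl.union (MeasurableSet.const _)).inter
    ((A.measurableSet_blindAction i _).compl.union (MeasurableSet.const _))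

open Classical in
/-- A device with blind energy `k` is compatible with a fraction of at least `2 ^ (-k)` of all
strings, since each non-idle round fixes one bit. -/
theorem two_pow_le_card_compatible (A : Algorithm M Ω) (r : ℕ) (ω : Ω) :
    2 ^ r ≤ 2 ^ A.blindEnergy r ω *
      (Finset.univ.filter fun z : Fin r → Bool => ω ∈ A.compatible z).card := by
  let s : Fin r → Finset Bool := fun i =>
    if A.blindAction ω i = .idle then Finset.univ
    else if A.blindAction ω i = .listen then {false} else {true}
  have hs : (Finset.univ.filter fun z : Fin r → Bool => ω ∈ A.compatible z) =
      Fintype.piFinset s := by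
    ext z
    rw [Finset.mem_filter_univ, Fintype.mem_piFinset]
    simp only [compatible, Set.mem_ofPred_eq, s]
    refine forall_congr' fun i => ?_
    cases A.blindAction ω i <;> simp [Action.message?]
  rw [hs, Fintype.card_piFinset, blindEnergy, Finset.card_filter, ← Finset.prod_pow_eq_pow_sum,
    ← Finset.prod_mul_distrib]
  calc 2 ^ r = ∏ i : Fin r, 2 := by simp
    _ ≤ _ := by
      refine Finset.prod_le_prod' fun i _ => ?_
      cases hi : A.blindAction ω i <;> simp [s, hi]

/-- Double counting of the pairs of a seed of blind energy less than `m` and a string `z` that it is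
compatible with, followed by the choice of the best `z`. -/
theorem exists_compatible_measure [Countable M] (A : Algorithm M Ω) (μ : Measure Ω) (r m : ℕ) :
    ∃ z : Fin r → Bool, μ {ω | A.blindEnergy r ω < m} ≤ 2 ^ m * μ (A.compatible z) := by
  classical
  set L := {ω | A.blindEnergy r ω < m} with hL
  have hLm : MeasurableSet L := (A.measurable_blindEnergy r) (measurableSet_Iio (a := m))
  by_contra! hcon
  have h1 : (2 : ℝ≥0∞) ^ r * μ L ≤ ∑ z : Fin r → Bool, 2 ^ m * μ (A.compatible z) := by
    calc (2 : ℝ≥0∞) ^ r * μ L = ∫⁻ ω, L.indicator (fun _ => 2 ^ r) ω ∂μ := by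
          rw [lintegral_indicator_const hLm]
      _ ≤ ∫⁻ ω, ∑ z : Fin r → Bool, (A.compatible z).indicator (fun _ => 2 ^ m) ω ∂μ := by
          refine lintegral_mono fun ω => ?_
          by_cases hω : ω ∈ L
          · have h2 := A.two_pow_le_card_compatible r ω
            have h3 : 2 ^ A.blindEnergy r ω ≤ 2 ^ m :=
              Nat.pow_le_pow_right (by norm_num) (le_of_lt hω)
            have h4 := h2.trans (Nat.mul_le_mul_right _ h3)
            simp only [Set.indicator_of_mem hω, Set.indicator_apply]
            rw [← Finset.sum_filter, Finset.sum_const, nsmul_eq_mul, mul_comm]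
            exact_mod_cast h4
          · simp [Set.indicator_of_notMem hω]
      _ = _ := by
          rw [lintegral_finsetSum]
          · refine Finset.sum_congr rfl fun z _ => ?_
            rw [lintegral_indicator_const (A.measurableSet_compatible z)]
          · exact fun z _ => measurable_const.indicator (A.measurableSet_compatible z)
  have h2 : ∑ z : Fin r → Bool, 2 ^ m * μ (A.compatible z) < ∑ _z : Fin r → Bool, μ L :=
    ENNReal.sum_lt_sum_of_nonempty Finset.univ_nonempty fun z _ => hcon z
  refine absurd (h1.trans_lt h2) ?_
  simp

/-- If all devices are compatible with the same string, then no round among the first `r` has both a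
transmitter and a listener, as the final round of an election on at least two devices must have. -/
theorem le_time_of_forall_compatible (A : Algorithm M Ω) {n r : ℕ} (hn : 2 ≤ n) (z : Fin r → Bool)
    (ω : Fin n → Ω) (h : ∀ v, ω v ∈ A.compatible z) : (r : ℝ≥0∞) ≤ A.time ω := by
  have hb : ∀ i < r, ∀ v, A.blindAction (ω v) i = .listen →
      ¬ ∃ u, (A.blindAction (ω u) i).message?.isSome := by
    rintro i hi v hv ⟨u, hu⟩
    have h1 := (h v ⟨i, hi⟩).2 hv
    have h2 := (h u ⟨i, hi⟩).1 hu
    simp [h1] at h2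
  refine le_iInf₂ fun s hs => ?_
  by_contra! hlt
  have hsr : s + 1 < r := by exact_mod_cast hlt
  obtain ⟨-, l, ⟨m, hm⟩, -, hl⟩ := hs
  have : Nontrivial (Fin n) := Fin.nontrivial_iff_two_le.2 hn
  obtain ⟨v, hv⟩ := exists_ne l
  have hact := A.actionAt_eq_blindAction ω r fun i hi v hv hu => hb i hi v hv hu.exists
  have h1 := (hl v hv).1
  rw [hact s (by omega)] at h1 hm
  exact hb s (by omega) v h1 ⟨l, by simp [hm, Action.message?]⟩

/-- Otherwise some string `z` is compatible with all `n` devices with probability at least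
`2 ^ (-(m + 3) * n)`, and then the time is at least `r`. -/
theorem measure_blindEnergy_lt_le [Countable M] (A : Algorithm M Ω) (μ : Measure Ω)
    [IsProbabilityMeasure μ] {n : ℕ} (hn : 2 ≤ n) (r m : ℕ)
    (hr : 2 ^ ((m + 3) * n) * A.expectedTime μ n < r) :
    μ {ω | A.blindEnergy r ω < m} ≤ 1 / 8 := by
  by_contra! hcon
  obtain ⟨z, hz⟩ := A.exists_compatible_measure μ r m
  have h1 : (1 : ℝ≥0∞) ≤ 2 ^ (m + 3) * μ (A.compatible z) := by
    calc (1 : ℝ≥0∞) = 8 * (1 / 8) := by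
          rw [one_div, ENNReal.mul_inv_cancel] <;> norm_num
      _ ≤ 8 * (2 ^ m * μ (A.compatible z)) := by gcongr; exact hcon.le.trans hz
      _ = _ := by rw [pow_add]; ring
  have h2 : (1 : ℝ≥0∞) ≤ 2 ^ ((m + 3) * n) * μ (A.compatible z) ^ n := by
    rw [pow_mul, ← mul_pow]; exact one_le_pow₀ h1
  have h3 : (r : ℝ≥0∞) * μ (A.compatible z) ^ n ≤ A.expectedTime μ n := by
    have hm : MeasurableSet (Set.univ.pi fun _ : Fin n => A.compatible z) :=
      MeasurableSet.univ_pi fun _ => A.measurableSet_compatible z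
    calc (r : ℝ≥0∞) * μ (A.compatible z) ^ n
        = ∫⁻ ω, (Set.univ.pi fun _ : Fin n => A.compatible z).indicator (fun _ => (r : ℝ≥0∞)) ω
            ∂(Measure.pi fun _ : Fin n => μ) := by
          rw [lintegral_indicator_const hm, Measure.pi_pi]
          simp
      _ ≤ _ := by
          refine lintegral_mono fun ω => ?_
          by_cases hω : ω ∈ Set.univ.pi fun _ : Fin n => A.compatible z
          · rw [Set.indicator_of_mem hω]
            exact A.le_time_of_forall_compatible hn z ω fun v => hω v trivial
          · simp [Set.indicator_of_notMem hω]
  refine absurd hr (not_lt.2 ?_)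
  calc (r : ℝ≥0∞) ≤ r * (2 ^ ((m + 3) * n) * μ (A.compatible z) ^ n) := le_mul_of_one_le_right' h2
    _ = 2 ^ ((m + 3) * n) * (r * μ (A.compatible z) ^ n) := by ring
    _ ≤ _ := by gcongr

end Algorithm

/-! ### Rounds with exactly one transmitter -/

theorem measure_existsUnique_mem_le [MeasurableSpace Ω] (μ : Measure Ω) [IsProbabilityMeasure μ]
    (n : ℕ) {S : Set Ω} (hS : MeasurableSet S) :
    (Measure.pi fun _ : Fin n => μ) {ω | ∃! u, ω u ∈ S} ≤
      ENNReal.ofReal (n * μ.real S * (1 - μ.real S) ^ (n - 1)) := by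
  classical
  have hsub : {ω : Fin n → Ω | ∃! u, ω u ∈ S} ⊆
      ⋃ u, Set.univ.pi fun v => if v = u then S else Sᶜ := by
    rintro ω ⟨u, hu, huniq⟩
    refine Set.mem_iUnion.2 ⟨u, fun v _ => ?_⟩
    by_cases hv : v = u
    · simpa [hv] using hu
    · simpa [hv] using fun hvS => hv (huniq v hvS)
  have hp : 0 ≤ 1 - μ.real S := by linarith [measureReal_le_one (μ := μ) (s := S)]
  refine (measure_mono hsub).trans ((measure_iUnion_le _).trans ?_)
  rw [tsum_fintype]
  have hterm : ∀ u : Fin n,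
      (Measure.pi fun _ : Fin n => μ) (Set.univ.pi fun v => if v = u then S else Sᶜ) =
        ENNReal.ofReal (μ.real S * (1 - μ.real S) ^ (n - 1)) := by
    intro u
    rw [Measure.pi_pi, ← Finset.mul_prod_erase _ _ (Finset.mem_univ u),
      Finset.prod_congr rfl (g := fun _ => μ Sᶜ)
        fun v hv => by rw [if_neg (Finset.ne_of_mem_erase hv)]]
    rw [if_pos rfl, Finset.prod_const, Finset.card_erase_of_mem (Finset.mem_univ u),
      Finset.card_univ, Fintype.card_fin, ENNReal.ofReal_mul measureReal_nonneg,
      ENNReal.ofReal_pow hp, ← probReal_compl_eq_one_sub hS, ofReal_measureReal,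
      ofReal_measureReal]
  simp_rw [hterm]
  rw [Finset.sum_const, Finset.card_univ, Fintype.card_fin, nsmul_eq_mul, mul_assoc,
    ENNReal.ofReal_mul (Nat.cast_nonneg n), ENNReal.ofReal_natCast]

/-- The probability of exactly one success in `n` trials is small if the expected number of
successes is very small or very large. -/
theorem exactly_one_le_of_extreme {n : ℕ} (hn : 2 ≤ n) {p r : ℝ} (hp0 : 0 ≤ p) (hp1 : p ≤ 1)
    (hr : 0 < r) (h : n * p ≤ 1 / (4 * r) ∨ 32 * r ≤ n * p) :
    n * p * (1 - p) ^ (n - 1) ≤ 1 / (4 * r) := by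
  rcases h with h | h
  · refine le_trans (mul_le_of_le_one_right (by positivity) ?_) h
    exact pow_le_one₀ (by linarith) (by linarith)
  · set x : ℝ := n * p with hx
    have hxpos : 0 < x := by linarith
    have hn' : (2 : ℝ) ≤ n := by exact_mod_cast hn
    have h1 : (1 - p) ^ (n - 1) ≤ Real.exp (-(x / 2)) := by
      calc (1 - p) ^ (n - 1) ≤ Real.exp (-p) ^ (n - 1) := by
            refine pow_le_pow_left₀ (by linarith) ?_ _
            linarith [Real.add_one_le_exp (-p)]
        _ = Real.exp (-(((n : ℝ) - 1) * p)) := by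
            rw [← Real.exp_nat_mul, Nat.cast_sub (by omega)]
            push_cast; ring_nf
        _ ≤ _ := by
            apply Real.exp_le_exp.2
            nlinarith
    have h2 : x ^ 2 / 8 ≤ Real.exp (x / 2) := by
      have := Real.quadratic_le_exp_of_nonneg (x := x / 2) (by positivity)
      nlinarith
    calc x * (1 - p) ^ (n - 1) ≤ x * Real.exp (-(x / 2)) := by gcongr
      _ = x / Real.exp (x / 2) := by rw [Real.exp_neg]; rfl
      _ ≤ x / (x ^ 2 / 8) := by gcongr
      _ = 8 / x := by field_simp
      _ ≤ 8 / (32 * r) := by gcongr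
      _ = 1 / (4 * r) := by field_simp; norm_num

/-- Consecutive powers of `128 r²` differ by the ratio of the endpoints of the interval
`(1 / (4 r), 32 r)`, so each `p i` brings at most one of these `r + 1` sizes into that interval. -/
theorem exists_size_avoiding {r : ℕ} (hr : 0 < r) (p : Fin r → ℝ) (hp : ∀ i, 0 ≤ p i) :
    ∃ j ≤ r, ∀ i, (((128 * r ^ 2) ^ (j + 1) : ℕ) : ℝ) * p i ≤ 1 / (4 * r) ∨
      32 * (r : ℝ) ≤ (((128 * r ^ 2) ^ (j + 1) : ℕ) : ℝ) * p i := by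
  by_contra! hcon
  have hcon' : ∀ j : Fin (r + 1), ∃ i, 1 / (4 * (r : ℝ)) <
      (((128 * r ^ 2) ^ (j.1 + 1) : ℕ) : ℝ) * p i ∧
      (((128 * r ^ 2) ^ (j.1 + 1) : ℕ) : ℝ) * p i < 32 * (r : ℝ) :=
    fun j => hcon j (by omega)
  choose f hf using hcon'
  have hr' : (1 : ℝ) ≤ r := by exact_mod_cast hr
  have key : ∀ j k : Fin (r + 1), j < k → f j ≠ f k := by
    intro j k hjk hfjk
    have h1 := (hf j).1
    have h2 := (hf k).2
    rw [← hfjk] at h2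
    have h3 : ((128 * r ^ 2 : ℕ) : ℝ) * ((128 * r ^ 2) ^ (j.1 + 1) : ℕ) ≤
        ((128 * r ^ 2) ^ (k.1 + 1) : ℕ) := by
      rw [← Nat.cast_mul, ← pow_succ']
      exact_mod_cast Nat.pow_le_pow_right (by positivity) (by have : j.1 < k.1 := hjk; omega)
    -- The factor `128 r²` carries the lower endpoint `1 / (4 r)` to the upper endpoint `32 r`.
    have h4 : 32 * (r : ℝ) = ((128 * r ^ 2 : ℕ) : ℝ) * (1 / (4 * r)) := by
      push_cast; field_simp; norm_num
    have h5 := mul_le_mul_of_nonneg_right h3 (hp (f j))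
    have h6 := mul_lt_mul_of_pos_left h1 (show (0 : ℝ) < ((128 * r ^ 2 : ℕ) : ℝ) by positivity)
    rw [← mul_assoc] at h6
    linarith
  have hinj : Function.Injective f := by
    intro j k hjk
    rcases lt_trichotomy j k with h | h | h
    · exact absurd hjk (key j k h)
    · exact h
    · exact absurd hjk.symm (key k j h)
  have := Fintype.card_le_of_injective f hinj
  simp at this

/-! ### The energy of the network -/

theorem log_log_size_le {r j n : ℕ} (hr : 128 ≤ r) (hj : j ≤ r)
    (hn : n = (128 * r ^ 2) ^ (j + 1)) : Real.log (Real.log n) ≤ 3 * Real.log r := by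
  have hr' : (128 : ℝ) ≤ r := by exact_mod_cast hr
  have hn1 : n ≤ r ^ (3 * (r + 1)) := by
    rw [hn, pow_mul]
    calc (128 * r ^ 2) ^ (j + 1) ≤ (r ^ 3) ^ (j + 1) := by
          gcongr
          rw [pow_succ' r 2]; gcongr
      _ ≤ _ := Nat.pow_le_pow_right (by positivity) (by omega)
  have hn2 : 2 ≤ n := by
    rw [hn]
    calc 2 ≤ 128 * r ^ 2 := by nlinarith
      _ ≤ _ := Nat.le_self_pow (by omega) _
  have hlogpos : 0 < Real.log n := Real.log_pos (by exact_mod_cast hn2)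
  have h1 : Real.log n ≤ (r : ℝ) ^ 3 := by
    calc Real.log n ≤ Real.log ((r : ℝ) ^ (3 * (r + 1))) := by
          apply Real.log_le_log (by positivity)
          exact_mod_cast hn1
      _ = 3 * (r + 1) * Real.log r := by rw [Real.log_pow]; push_cast; ring
      _ ≤ 3 * (r + 1) * r := by gcongr; exact Real.log_le_self (by positivity)
      _ ≤ (r : ℝ) ^ 3 := by nlinarith [sq_nonneg (r : ℝ)]
  calc Real.log (Real.log n) ≤ Real.log ((r : ℝ) ^ 3) := Real.log_le_log hlogpos h1
    _ = 3 * Real.log r := by rw [Real.log_pow]; norm_num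

open Classical in
/-- Markov's inequality for the number of devices with seed in `S`. -/
theorem measure_half_le_card_mem_le [MeasurableSpace Ω] (μ : Measure Ω) [IsProbabilityMeasure μ]
    {n : ℕ} (hn : 0 < n) {S : Set Ω} (hS : MeasurableSet S) (h : μ S ≤ 1 / 8) :
    (Measure.pi fun _ : Fin n => μ)
      {ω | (n : ℝ≥0∞) / 2 ≤ ((Finset.univ.filter fun v => ω v ∈ S).card : ℝ≥0∞)} ≤ 1 / 4 := by
  have hcard : ∀ ω : Fin n → Ω, ((Finset.univ.filter fun v => ω v ∈ S).card : ℝ≥0∞) =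
      ∑ v, S.indicator (fun _ => 1) (ω v) := by
    intro ω
    simp [Set.indicator_apply]
  have hmeas : ∀ v : Fin n,
      Measurable fun ω : Fin n → Ω => S.indicator (fun _ => (1 : ℝ≥0∞)) (ω v) :=
    fun v => (measurable_const.indicator hS).comp (measurable_pi_apply v)
  have hint : ∫⁻ ω : Fin n → Ω, ∑ v, S.indicator (fun _ => (1 : ℝ≥0∞)) (ω v)
      ∂(Measure.pi fun _ : Fin n => μ) = n * μ S := by
    rw [lintegral_finsetSum _ fun v _ => hmeas v]
    have : ∀ v : Fin n, ∫⁻ ω : Fin n → Ω, S.indicator (fun _ => (1 : ℝ≥0∞)) (ω v)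
        ∂(Measure.pi fun _ : Fin n => μ) = μ S := by
      intro v
      rw [(measurePreserving_eval (fun _ : Fin n => μ) v).lintegral_comp
        (measurable_const.indicator hS), lintegral_indicator_const hS, one_mul]
    simp [this]
  have hn0 : (n : ℝ≥0∞) / 2 ≠ 0 := by simp [hn.ne']
  have hnt : (n : ℝ≥0∞) / 2 ≠ ∞ := ENNReal.div_ne_top (by simp) (by simp)
  simp_rw [hcard]
  refine (meas_ge_le_lintegral_div (Finset.measurable_sum _ fun v _ => hmeas v).aemeasurable
    hn0 hnt).trans ?_
  rw [hint]
  refine ENNReal.div_le_of_le_mul ?_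
  calc (n : ℝ≥0∞) * μ S ≤ n * (1 / 8) := by gcongr
    _ = 1 / 4 * (n / 2) := by
      rw [← ENNReal.toReal_eq_toReal_iff' (by simp [ENNReal.mul_eq_top])
        (ENNReal.mul_ne_top (by simp) hnt)]
      simp
      ring

namespace Algorithm

variable [MeasurableSpace Ω]

open Classical in
theorem half_le_averageEnergy (A : Algorithm M Ω) {n r m : ℕ} (hn : 0 < n) (ω : Fin n → Ω)
    (hblind : ∀ i : Fin r, ¬ ∃! u, (A.blindAction (ω u) i).message?.isSome)
    {S : Set Ω} (hS : ∀ ω ∉ S, m ≤ A.blindEnergy r ω)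
    (hlow : ((Finset.univ.filter fun v => ω v ∈ S).card : ℝ≥0∞) < (n : ℝ≥0∞) / 2) :
    (m : ℝ≥0∞) / 2 ≤ A.averageEnergy ω := by
  set L := Finset.univ.filter fun v => ω v ∈ S with hL
  have hE := A.blindEnergy_le_energy ω r fun i hi v _ => hblind ⟨i, hi⟩
  have hcard : (n : ℝ≥0∞) / 2 ≤ (Lᶜ.card : ℝ≥0∞) := by
    have h1 : (L.card : ℝ≥0∞) + Lᶜ.card = n / 2 + n / 2 := by
      rw [ENNReal.add_halves, ← Nat.cast_add, Finset.card_add_card_compl, Fintype.card_fin]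
    by_contra! h2
    exact absurd h1 (ENNReal.add_lt_add hlow h2).ne
  rw [averageEnergy, ENNReal.le_div_iff_mul_le (by simp [hn.ne']) (by simp)]
  calc (m : ℝ≥0∞) / 2 * n = n / 2 * m := by simp only [div_eq_mul_inv]; ring
    _ ≤ Lᶜ.card * m := by gcongr
    _ = ∑ v ∈ Lᶜ, (m : ℝ≥0∞) := by simp
    _ ≤ ∑ v ∈ Lᶜ, A.energy ω v := by
      refine Finset.sum_le_sum fun v hv => le_trans ?_ (hE v)
      exact_mod_cast hS _ (by simpa [hL] using hv)
    _ ≤ ∑ v, A.energy ω v := Finset.sum_le_sum_of_subset (Finset.subset_univ _)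

theorem averageEnergy_le_maxEnergy (A : Algorithm M Ω) {n : ℕ} (ω : Fin n → Ω) :
    A.averageEnergy ω ≤ A.maxEnergy ω := by
  refine ENNReal.div_le_of_le_mul ?_
  calc ∑ v, A.energy ω v ≤ ∑ _v : Fin n, A.maxEnergy ω :=
        Finset.sum_le_sum fun v _ => le_iSup (A.energy ω) v
    _ = _ := by simp [mul_comm]

open Classical in
/-- The event is given as a measurable set `G`, so that it can also be used to bound the expected
energy from below. -/
theorem exists_measurableSet_half_le_averageEnergy [Countable M] (A : Algorithm M Ω)
    (μ : Measure Ω) [IsProbabilityMeasure μ] {n r m : ℕ} (hn : 2 ≤ n) (hr : 0 < r)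
    (hlow : μ {ω | A.blindEnergy r ω < m} ≤ 1 / 8)
    (hext : ∀ i : Fin r,
      n * μ.real {ω | (A.blindAction ω i).message?.isSome} ≤ 1 / (4 * (r : ℝ)) ∨
        32 * (r : ℝ) ≤ n * μ.real {ω | (A.blindAction ω i).message?.isSome}) :
    ∃ G : Set (Fin n → Ω), MeasurableSet G ∧ 1 / 2 ≤ (Measure.pi fun _ : Fin n => μ) G ∧
      ∀ ω ∈ G, (m : ℝ≥0∞) / 2 ≤ A.averageEnergy ω := by
  set P := Measure.pi fun _ : Fin n => μ
  let B : Fin r → Set (Fin n → Ω) := fun i =>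
    {ω | ∃! u, ω u ∈ {ω | (A.blindAction ω i).message?.isSome}}
  obtain ⟨L, hL⟩ : ∃ L, L = {ω | A.blindEnergy r ω < m} := ⟨_, rfl⟩
  have hLm : MeasurableSet L :=
    hL ▸ A.measurable_blindEnergy r (measurableSet_Iio (a := m))
  rw [← hL] at hlow
  let H : Set (Fin n → Ω) := {ω | (n : ℝ≥0∞) / 2 ≤
    ((Finset.univ.filter fun v => ω v ∈ L).card : ℝ≥0∞)}
  have hr' : (0 : ℝ) < r := by exact_mod_cast hr
  have hB : P (⋃ i, B i) ≤ 1 / 4 := by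
    calc P (⋃ i, B i) ≤ ∑ i, P (B i) := (measure_iUnion_le _).trans (tsum_fintype _).le
      _ ≤ ∑ _i : Fin r, ENNReal.ofReal (1 / (4 * r)) := by
        refine Finset.sum_le_sum fun i _ => ?_
        have h1 := measure_existsUnique_mem_le μ n (A.measurableSet_blindTransmit i)
        have h2 := exactly_one_le_of_extreme hn measureReal_nonneg measureReal_le_one hr' (hext i)
        exact h1.trans (ENNReal.ofReal_le_ofReal h2)
      _ = ENNReal.ofReal (r * (1 / (4 * r))) := by
        rw [Finset.sum_const, Finset.card_univ, Fintype.card_fin, nsmul_eq_mul,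
          ENNReal.ofReal_mul hr'.le, ENNReal.ofReal_natCast]
      _ = ENNReal.ofReal (1 / 4) := by congr 1; field_simp
      _ = 1 / 4 := by rw [ENNReal.ofReal_div_of_pos (by norm_num)]; norm_num
  have hH : P H ≤ 1 / 4 := measure_half_le_card_mem_le μ (by omega) hLm hlow
  -- The set `H` and the sets `B i` are enlarged to one measurable set of the same measure as
  -- their union, which avoids proving that they are measurable.
  let N := toMeasurable P ((⋃ i, B i) ∪ H)
  have hN : P N ≤ 1 / 2 := by
    rw [measure_toMeasurable]
    calc P ((⋃ i, B i) ∪ H) ≤ 1 / 4 + 1 / 4 := (measure_union_le _ _).trans (add_le_add hB hH)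
      _ = 1 / 2 := by
        rw [← ENNReal.toReal_eq_toReal_iff' (by simp) (by simp),
          ENNReal.toReal_add (by simp) (by simp)]
        norm_num
  have hNm : MeasurableSet N := measurableSet_toMeasurable P _
  refine ⟨Nᶜ, hNm.compl, ?_, fun ω hω => ?_⟩
  · rw [prob_compl_eq_one_sub hNm]
    calc (1 : ℝ≥0∞) / 2 = 1 - 1 / 2 := by simp
      _ ≤ _ := tsub_le_tsub_left hN 1
  · have hω' : ω ∉ (⋃ i, B i) ∪ H := fun h => hω (subset_toMeasurable _ _ h)
    rw [Set.mem_union, not_or, Set.mem_iUnion, not_exists] at hω'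
    exact A.half_le_averageEnergy (by omega) ω (fun i => hω'.1 i)
      (fun ω h => not_lt.1 fun hlt => h (hL ▸ hlt)) (not_le.1 hω'.2)

end Algorithm

end NoCD

theorem theorem1 (nStar : ℕ) (hnStar : 2 ≤ nStar) :
    ∃ c : ℝ, 0 < c ∧
      ∀ (M Ω : Type*) [Countable M] [MeasurableSpace Ω] (μ : Measure Ω) [IsProbabilityMeasure μ]
        (A : NoCD.Algorithm M Ω), A.expectedTime μ nStar < ∞ →
        {n : ℕ |
          ENNReal.ofReal (c * Real.log (Real.log n)) ≤ A.expectedEnergy μ n ∧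
          1 / 2 ≤ (Measure.pi fun _ : Fin n => μ)
            {ω | ENNReal.ofReal (c * Real.log (Real.log n)) ≤ A.averageEnergy ω}}.Infinite := by
  have hN : (2 : ℝ) ≤ nStar := by exact_mod_cast hnStar
  refine ⟨1 / (96 * nStar), by positivity, ?_⟩
  intro M Ω _ _ μ _ A hT
  refine Set.infinite_of_forall_exists_gt fun a => ?_
  obtain ⟨t, ht⟩ := ENNReal.exists_nat_gt hT.ne
  -- `m` is large enough for `T(nStar) < 2 ^ q` and for a size above `a`; `r = 2 ^ q * 2 ^ q` then
  -- exceeds `2 ^ q * T(nStar)` while `log r` remains linear in `m`.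
  set m := a + t + 1 with hm
  set q := (m + 3) * nStar with hq
  have hqm : m + 3 ≤ q := Nat.le_mul_of_pos_right _ (by omega)
  set r := 2 ^ (2 * q) with hr
  have hqr : q < r := (Nat.lt_two_pow_self).trans_le (Nat.pow_le_pow_right (by omega) (by omega))
  have hr128 : 128 ≤ r := by
    calc 128 = 2 ^ 7 := by norm_num
      _ ≤ r := Nat.pow_le_pow_right (by omega) (by nlinarith)
  have hTr : 2 ^ q * A.expectedTime μ nStar < r := by
    have h1 : A.expectedTime μ nStar < 2 ^ q := by
      refine ht.trans_le ?_
      have : t ≤ 2 ^ q := (show t ≤ q by omega).trans Nat.lt_two_pow_self.le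
      exact_mod_cast this
    calc 2 ^ q * A.expectedTime μ nStar < 2 ^ q * 2 ^ q :=
          ENNReal.mul_lt_mul_right (by simp) (by simp) h1
      _ = r := by rw [hr, two_mul, pow_add]; push_cast; rfl
  have hlow := A.measure_blindEnergy_lt_le μ hnStar r m hTr
  obtain ⟨j, hj, hext⟩ := NoCD.exists_size_avoiding (by omega : 0 < r)
    (fun i : Fin r => μ.real {ω | (A.blindAction ω i).message?.isSome}) fun _ => measureReal_nonneg
  set n := (128 * r ^ 2) ^ (j + 1) with hn
  have hnr : r ≤ n := by
    calc r ≤ 128 * r ^ 2 := by nlinarith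
      _ ≤ n := Nat.le_self_pow (by omega) _
  obtain ⟨G, hGm, hG, hGE⟩ :=
    A.exists_measurableSet_half_le_averageEnergy μ (by omega : 2 ≤ n) (by omega) hlow hext
  have hc : 1 / (96 * nStar) * Real.log (Real.log n) ≤ m / 4 := by
    have h1 := NoCD.log_log_size_le hr128 hj hn
    have h2 : Real.log r ≤ 2 * q := by
      rw [hr]
      push_cast
      rw [Real.log_pow]
      have : Real.log 2 ≤ 1 := by linarith [Real.log_two_lt_d9]
      push_cast
      exact mul_le_of_le_one_right (by positivity) this
    have h3 : (q : ℝ) ≤ 4 * m * nStar := by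
      have : q ≤ 4 * m * nStar := Nat.mul_le_mul_right _ (by omega)
      exact_mod_cast this
    rw [div_mul_eq_mul_div, one_mul, div_le_iff₀ (by positivity)]
    nlinarith
  have hc' : ENNReal.ofReal (1 / (96 * nStar) * Real.log (Real.log n)) ≤ (m : ℝ≥0∞) / 2 / 2 := by
    refine (ENNReal.ofReal_le_ofReal hc).trans_eq ?_
    rw [ENNReal.ofReal_div_of_pos (by norm_num), ENNReal.ofReal_natCast, div_eq_mul_inv,
      div_eq_mul_inv, div_eq_mul_inv, mul_assoc, ← ENNReal.mul_inv (by simp) (by simp)]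
    norm_num
  refine ⟨n, ⟨?_, ?_⟩, by omega⟩
  · calc _ ≤ (m : ℝ≥0∞) / 2 / 2 := hc'
      _ ≤ m / 2 * (Measure.pi fun _ : Fin n => μ) G := by
        rw [div_eq_mul_inv _ (2 : ℝ≥0∞), ← one_div (2 : ℝ≥0∞)]
        gcongr
      _ = ∫⁻ ω, G.indicator (fun _ => (m : ℝ≥0∞) / 2) ω ∂(Measure.pi fun _ : Fin n => μ) := by
        rw [lintegral_indicator_const hGm]
      _ ≤ A.expectedEnergy μ n := by
        refine lintegral_mono fun ω => ?_
        by_cases hω : ω ∈ G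
        · rw [Set.indicator_of_mem hω]
          exact (hGE ω hω).trans (A.averageEnergy_le_maxEnergy ω)
        · simp [Set.indicator_of_notMem hω]
  · refine hG.trans (measure_mono fun ω hω => ?_)
    exact (hc'.trans ENNReal.half_le_self).trans (hGE ω hω)
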